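/- A ribbon graph is a surface with boundary formed from finitely many closed discs, called vertex-discs (their set is $V(G)$) and edge-ribbons (their set is $E(G)$), which meet in disjoint line segments, each lying on the boundary of exactly one vertex-disc and exactly one edge-ribbon, every edge-ribbon containing exactly two of them (its half-edges). Up to homeomorphism it is given by a signed rotation system: a cyclic order of the half-edges at each vertex-disc, and a sign $\pm$ on each half-edge, the edge-ribbon being twisted if its two half-edges carry opposite signs and untwisted if they carry the same sign. With $F(G)$ the set of boundary components and $c(G)$ the number of connected components, the Euler genus is $\varepsilon(G)=2c(G)-|V(G)|+|E(G)|-|F(G)|$. For $A\subseteq E(G)$, the partial Petrial $G^{\times|A}$ is obtained from $G$ by detaching one end of each edge-ribbon in $A$, giving the ribbon a half-twist, and reattaching that end. A bouquet $B$ is a ribbon graph with exactly one vertex-disc. Its modified partial Petrial polynomial is $${}^{M\partial}\varepsilon^{\times}_{B}(z)=\sum_{A\subseteq E(B)}(-1)^{|A|}z^{\varepsilon(B^{\times|A})}\in\mathbb{Z}[z].$$ Its intersection graph $I(B)$ has vertex set $E(B)$, two distinct edges being adjacent if and only if they are interlaced, that is, their half-edges alternate in the cyclic order at the vertex-disc.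 Its signed intersection graph $SI(B)$ is $I(B)$ with each vertex labelled $-$ if the edge is twisted and $+$ if it is untwisted. Two bouquets have the same intersection graph (signed intersection graph) if there is a graph isomorphism (a graph isomorphism preserving the vertex signs) between these graphs. Let $B_1,B_2$ be bouquets. 1. If $B_1$ and $B_2$ have the same signed intersection graph, then ${}^{M\partial}\varepsilon^{\times}_{B_1}(z)={}^{M\partial}\varepsilon^{\times}_{B_2}(z)$. 2. More generally, if $B_1$ and $B_2$ have the same intersection graph, $\phi:E(B_1)\to E(B_2)$ is any isomorphism from $I(B_1)$ to $I(B_2)$, and $T_1$, $T_2$ are the sets of twisted edges of $B_1$, $B_2$, then $${}^{M\partial}\varepsilon^{\times}_{B_1}(z)=(-1)^{|\phi(T_1)\,\triangle\,T_2|}\;{}^{M\partial}\varepsilon^{\times}_{B_2}(z).$$ -/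

import Mathlib

open Polynomial
open scoped symmDiff

/-- `w`, `x`, `y`, `z` are met in this order, at pairwise distinct positions, during one turn around
the cycle of the permutation `σ` that starts at `w`. -/
def CyclicallyOrdered {α : Type*} (σ : Equiv.Perm α) (w x y z : α) : Prop :=
  ∃ i j k : ℕ, 0 < i ∧ i < j ∧ j < k ∧ k < Function.minimalPeriod σ w ∧
    σ^[i] w = x ∧ σ^[j] w = y ∧ σ^[k] w = z

theorem CyclicallyOrdered.rotate {α : Type*} {σ : Equiv.Perm α} {w x y z : α}
    (h : CyclicallyOrdered σ w x y z) : CyclicallyOrdered σ x y z w := by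
  obtain ⟨i, j, k, hi, hij, hjk, hk, rfl, rfl, rfl⟩ := h
  have hp : w ∈ Function.periodicPts σ :=
    Function.minimalPeriod_pos_iff_mem_periodicPts.1 (by omega)
  refine ⟨j - i, k - i, Function.minimalPeriod σ w - i, by omega, by omega, by omega, ?_, ?_, ?_, ?_⟩
  · rw [Function.minimalPeriod_apply_iterate hp]
    omega
  · rw [← Function.iterate_add_apply]
    congr 2
    omega
  · rw [← Function.iterate_add_apply]
    congr 2
    omega
  · rw [← Function.iterate_add_apply, Nat.sub_add_cancel (by omega)]
    exact Function.iterate_minimalPeriod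

/-- A ribbon graph with vertex-discs `V` and edge-ribbons `E`, given by a signed rotation system.
The two ends (half-edges) of the edge-ribbon `e` are `(e, false)` and `(e, true)`. Every vertex-disc
carries an orientation of its boundary circle, and `rot` sends a half-edge to the next one on the
same vertex-disc; a vertex-disc without half-edges is isolated. Equal signs at the two ends of an
edge-ribbon mean that the ribbon is attached flat with respect to the orientations of the
vertex-discs at its ends, opposite signs mean that it is attached with a half-twist. -/
structure RibbonGraph (V E : Type*) where
  /-- the vertex-disc at which a half-edge is attached -/
  vert : E × Bool → V
  /-- the rotation, that is, the cyclic order of the half-edges at every vertex-disc -/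
  rot : Equiv.Perm (E × Bool)
  /-- the half-edges at one vertex-disc form one cycle of the rotation -/
  sameCycle_iff : ∀ h h' : E × Bool, rot.SameCycle h h' ↔ vert h = vert h'
  /-- the signs of the half-edges -/
  sign : E × Bool → ℤˣ

/-- A graph whose vertices are labelled with the sign `1` or `-1`; its underlying graph is
simple. -/
structure SignedGraph (W : Type*) where
  /-- the underlying graph -/
  graph : SimpleGraph W
  /-- the signs of the vertices -/
  sign : W → ℤˣ

/-- An isomorphism of signed graphs: an isomorphism of the underlying graphs that preserves the
signs of the vertices. -/
structure SignedGraph.Iso {W W' : Type*} (S : SignedGraph W) (S' : SignedGraph W') extends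
    S.graph ≃g S'.graph where
  sign_eq : ∀ w : W, S'.sign (toFun w) = S.sign w

namespace RibbonGraph

variable {V E : Type*}

/-- A bouquet is a ribbon graph with exactly one vertex-disc. -/
def IsBouquet (_G : RibbonGraph V E) : Prop := Nat.card V = 1

/-- The set of twisted edges: those whose two half-edges carry opposite signs. -/
def twisted (G : RibbonGraph V E) : Set E := {e | G.sign (e, false) ≠ G.sign (e, true)}

open Classical in
/-- The partial Petrial with respect to `A`: one end of every edge-ribbon in `A` is detached, the
ribbon is given a half-twist, and the end is attached again at the same place. -/
noncomputable def partialPetrial (G : RibbonGraph V E) (A : Finset E) : RibbonGraph V E where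
  vert := G.vert
  rot := G.rot
  sameCycle_iff := G.sameCycle_iff
  sign h := if h.1 ∈ A ∧ h.2 = false then -G.sign h else G.sign h

/-- The segment along which the half-edge `h` is attached to its vertex-disc has two end points:
`(h, false)`, where it begins, and `(h, true)`, where it finishes, in the direction of the
orientation of the vertex-disc. Away from isolated vertex-discs, the boundary of the ribbon graph
consists of arcs that join these points: the arcs of the vertex-discs between consecutive
half-edges, and the two free sides of every edge-ribbon. -/
inductive BoundaryArc (G : RibbonGraph V E) : (E × Bool) × Bool → (E × Bool) × Bool → Prop
  | vertexArc (h : E × Bool) : BoundaryArc G (h, true) (G.rot h, false)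
  | untwistedSide (e : E) (b : Bool) (he : e ∉ G.twisted) :
      BoundaryArc G ((e, false), b) ((e, true), !b)
  | twistedSide (e : E) (b : Bool) (he : e ∈ G.twisted) :
      BoundaryArc G ((e, false), b) ((e, true), b)

/-- The faces, that is, the boundary components: the closed curves formed by the boundary arcs, and
the boundary circles of the isolated vertex-discs. (`Quot` is the quotient by the equivalence
relation that the relation generates.) -/
def Face (G : RibbonGraph V E) : Type _ :=
  Quot G.BoundaryArc ⊕ {v : V // ∀ h : E × Bool, G.vert h ≠ v}

/-- The connected components: classes of vertex-discs under being joined by edge-ribbons. -/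
def Component (G : RibbonGraph V E) : Type _ :=
  Quot fun v w : V => ∃ e : E, G.vert (e, false) = v ∧ G.vert (e, true) = w

/-- The Euler characteristic `|V| - |E| + |F|`. -/
noncomputable def eulerChar (G : RibbonGraph V E) : ℤ :=
  (Nat.card V : ℤ) - Nat.card E + Nat.card G.Face

/-- The Euler genus `2c - χ`. -/
noncomputable def eulerGenus (G : RibbonGraph V E) : ℤ :=
  2 * (Nat.card G.Component : ℤ) - G.eulerChar

/-- The modified partial Petrial polynomial, the sum of `(-1) ^ |A| * z ^ ε(G^{×|A})` over all sets
`A` of edges. The Euler genus of a finite ribbon graph is never negative, so that `Int.toNat` only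
turns it into a natural number. -/
noncomputable def modifiedPartialPetrialPolynomial [Fintype E] (G : RibbonGraph V E) : ℤ[X] :=
  ∑ A : Finset E, (-1) ^ A.card * X ^ (G.partialPetrial A).eulerGenus.toNat

/-- Two different edges are interlaced if their half-edges alternate in the rotation. -/
def Interlaced (G : RibbonGraph V E) (a b : E) : Prop :=
  a ≠ b ∧ ∃ s t : Bool, CyclicallyOrdered G.rot (a, s) (b, t) (a, !s) (b, !t)

/-- The intersection graph: its vertices are the edges of the ribbon graph, and they are adjacent
if they are interlaced. -/
def intersectionGraph (G : RibbonGraph V E) : SimpleGraph E where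
  Adj := G.Interlaced
  symm := ⟨by
    rintro a b ⟨hab, s, t, h⟩
    exact ⟨hab.symm, t, !s, by simpa using h.rotate⟩⟩
  loopless := ⟨fun _ h => h.1 rfl⟩

open Classical in
/-- The signed intersection graph: the sign of a vertex is `-1` if the edge is twisted, and `1`
otherwise. -/
noncomputable def signedIntersectionGraph (G : RibbonGraph V E) : SignedGraph E where
  graph := G.intersectionGraph
  sign e := if e ∈ G.twisted then -1 else 1

end RibbonGraph

/-! The signed intersection graph of a bouquet determines its number of faces. Take a `ZMod
2`-valued function constant on boundary curves and let `x e` be its jump across an end of `e`;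
modulo two, both ends give the same jump. Walking along the disc from one end of `e` to the other
meets `e` once, interlaced edges once and all others zero or two times. The sides of the ribbon
prescribe the total change, which says exactly that `x` lies in the kernel of the adjacency matrix
with the twisted edges marked on its diagonal. A base value and a kernel vector recover the
function, so `2 ^ |F| = 2 * |ker|` (`two_pow_card_face`), and the Euler genus follows. The partial
Petrial for `A` has twisted set `A ∆ T`. With `S = φ(T₁) ∆ T₂`, the bijection `A ↦ S ∆ φ(A)`
therefore matches terms of equal genus, and their signs differ by `(-1) ^ |S|`. -/

/-! ### Functions along a single cycle -/

namespace Equiv.Perm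

variable {α : Type*} [Fintype α] {σ : Equiv.Perm α}

theorem isCycleOn_univ_of_sameCycle (hσ : ∀ a b, σ.SameCycle a b) :
    σ.IsCycleOn ((Finset.univ : Finset α) : Set α) :=
  ⟨by simp, fun a _ b _ => hσ a b⟩

theorem minimalPeriod_eq_card_of_sameCycle (hσ : ∀ a b, σ.SameCycle a b) (a : α) :
    Function.minimalPeriod σ a = Fintype.card α := by
  have h (n : ℕ) : Function.minimalPeriod σ a ∣ n ↔ Fintype.card α ∣ n := by
    rw [← Function.isPeriodicPt_iff_minimalPeriod_dvd, Function.IsPeriodicPt, Function.IsFixedPt,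
      Equiv.Perm.iterate_eq_pow, (isCycleOn_univ_of_sameCycle hσ).pow_apply_eq (Finset.mem_univ a),
      Finset.card_univ]
  exact Nat.dvd_antisymm ((h _).2 dvd_rfl) ((h _).1 dvd_rfl)

theorem exists_iterate_eq_of_sameCycle (hσ : ∀ a b, σ.SameCycle a b) (a b : α) :
    ∃ i < Fintype.card α, σ^[i] a = b := by
  obtain ⟨i, hi, h⟩ := (isCycleOn_univ_of_sameCycle hσ).exists_pow_eq
    (Finset.mem_univ a) (Finset.mem_univ b)
  exact ⟨i, by simpa using hi, by rwa [Equiv.Perm.iterate_eq_pow]⟩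

theorem iterate_inj_of_sameCycle (hσ : ∀ a b, σ.SameCycle a b) {a : α} {i j : ℕ}
    (hi : i < Fintype.card α) (hj : j < Fintype.card α) (h : σ^[i] a = σ^[j] a) : i = j := by
  rw [← minimalPeriod_eq_card_of_sameCycle hσ a] at hi hj
  exact Function.iterate_injOn_Iio_minimalPeriod hi hj h

open Classical in
theorem sum_range_iterate_of_sameCycle {M : Type*} [AddCommMonoid M]
    (hσ : ∀ a b, σ.SameCycle a b) (a : α) (y : α → M) {d : ℕ} (hd : d ≤ Fintype.card α) :
    ∑ j ∈ Finset.range d, y (σ^[j] a) = ∑ b, if ∃ j < d, σ^[j] a = b then y b else 0 := by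
  rw [← Finset.sum_filter]
  refine Finset.sum_nbij (fun j => σ^[j] a) ?_ ?_ ?_ fun _ _ => rfl
  · intro j hj
    simpa using ⟨j, by simpa using hj, rfl⟩
  · intro i hi j hj h
    simp only [Finset.coe_range, Set.mem_Iio] at hi hj
    exact iterate_inj_of_sameCycle hσ (by omega) (by omega) h
  · intro b hb
    obtain ⟨j, hj, rfl⟩ := (Finset.mem_filter.1 hb).2
    exact ⟨j, by simpa using hj, rfl⟩

theorem apply_iterate_eq_add_sum {α M : Type*} [AddCommMonoid M] {σ : Equiv.Perm α} {u y : α → M}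
    (hu : ∀ b, u (σ b) = u b + y b) (a : α) (i : ℕ) :
    u (σ^[i] a) = u a + ∑ j ∈ Finset.range i, y (σ^[j] a) := by
  induction i with
  | zero => simp
  | succ i ih => rw [Function.iterate_succ_apply', hu, ih, Finset.sum_range_succ, add_assoc]

theorem eq_of_increments_eq {M : Type*} [AddCommMonoid M] (hσ : ∀ a b, σ.SameCycle a b)
    {u v y : α → M} (hu : ∀ b, u (σ b) = u b + y b) (hv : ∀ b, v (σ b) = v b + y b) {a : α}
    (ha : u a = v a) : u = v := by
  funext b
  obtain ⟨i, -, rfl⟩ := exists_iterate_eq_of_sameCycle hσ a b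
  rw [apply_iterate_eq_add_sum hu, apply_iterate_eq_add_sum hv, ha]

theorem exists_increments_eq {M : Type*} [AddCommMonoid M] (hσ : ∀ a b, σ.SameCycle a b)
    (a : α) (c : M) {y : α → M} (hy : ∑ b, y b = 0) :
    ∃ u : α → M, u a = c ∧ ∀ b, u (σ b) = u b + y b := by
  classical
  choose p hp hpa using exists_iterate_eq_of_sameCycle hσ a
  have hpos : 0 < Fintype.card α := Fintype.card_pos_iff.2 ⟨a⟩
  have hpa0 : p a = 0 := iterate_inj_of_sameCycle hσ (hp a) hpos (hpa a)
  have htot : ∑ j ∈ Finset.range (Fintype.card α), y (σ^[j] a) = 0 := by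
    rw [sum_range_iterate_of_sameCycle hσ a y le_rfl, ← hy]
    exact Finset.sum_congr rfl fun b _ => if_pos (exists_iterate_eq_of_sameCycle hσ a b)
  refine ⟨fun b => c + ∑ j ∈ Finset.range (p b), y (σ^[j] a), by simp [hpa0], fun b => ?_⟩
  have hstep : c + ∑ j ∈ Finset.range (p b), y (σ^[j] a) + y b =
      c + ∑ j ∈ Finset.range (p b + 1), y (σ^[j] a) := by
    rw [Finset.sum_range_succ, hpa, add_assoc]
  have hit : σ^[p b + 1] a = σ b := by rw [Function.iterate_succ_apply', hpa]
  simp only [hstep]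
  rcases (Nat.succ_le_of_lt (hp b)).lt_or_eq with h | h
  · rw [iterate_inj_of_sameCycle hσ (hp (σ b)) h ((hpa (σ b)).trans hit.symm)]
  -- The walk closes up here: the accumulated increment is the full sum, which vanishes by `hy`.
  · have hper : σ^[p b + 1] a = a := by
      rw [← Nat.succ_eq_add_one, h, ← minimalPeriod_eq_card_of_sameCycle hσ a]
      exact Function.iterate_minimalPeriod
    rw [← Nat.succ_eq_add_one, h, htot, ← hit, hper, hpa0]
    simp

end Equiv.Perm

/-! ### Counting the faces of a bouquet modulo two -/

namespace RibbonGraph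

variable {V E : Type*}

theorem IsBouquet.subsingleton {G : RibbonGraph V E} (hG : G.IsBouquet) : Subsingleton V :=
  (Nat.card_eq_one_iff_unique.1 hG).1

theorem IsBouquet.sameCycle {G : RibbonGraph V E} (hG : G.IsBouquet) (a b : E × Bool) :
    G.rot.SameCycle a b :=
  (G.sameCycle_iff a b).2 (hG.subsingleton.elim _ _)

theorem interlaced_iff (G : RibbonGraph V E) (a b : E) :
    G.Interlaced a b ↔ a ≠ b ∧
      ∃ t : Bool, CyclicallyOrdered G.rot (a, false) (b, t) (a, true) (b, !t) := by
  refine and_congr_right fun _ => ⟨?_, fun ⟨t, h⟩ => ⟨false, t, h⟩⟩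
  rintro ⟨_ | _, t, h⟩
  · exact ⟨t, h⟩
  · exact ⟨!t, by simpa using h.rotate.rotate⟩

/-- The sides of a ribbon carry the jump at one end to plus or minus the jump at the other, and
modulo two the sign is lost. So both ends of an edge contribute the same increment. -/
theorem apply_rot_eq {G : RibbonGraph V E} (q : Quot G.BoundaryArc → ZMod 2) (h : E × Bool) :
    q (Quot.mk _ (G.rot h, false)) = q (Quot.mk _ (h, false)) +
      (q (Quot.mk _ ((h.1, false), true)) - q (Quot.mk _ ((h.1, false), false))) := by
  rw [← Quot.sound (BoundaryArc.vertexArc h)]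
  obtain ⟨e, _ | _⟩ := h
  · simp
  · have h2 : (2 : ZMod 2) = 0 := rfl
    by_cases he : e ∈ G.twisted
    · rw [Quot.sound (BoundaryArc.twistedSide e true he),
        Quot.sound (BoundaryArc.twistedSide e false he)]
      ring
    · rw [Quot.sound (BoundaryArc.untwistedSide e true he),
        Quot.sound (BoundaryArc.untwistedSide e false he)]
      simp only [Bool.not_true, Bool.not_false]
      linear_combination (q (Quot.mk _ ((e, true), true)) - q (Quot.mk _ ((e, true), false))) * h2

theorem IsBouquet.card_component {G : RibbonGraph V E} (hG : G.IsBouquet) : Nat.card G.Component = 1 := by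
  obtain ⟨hs, ⟨v⟩⟩ := Nat.card_eq_one_iff_unique.1 hG
  refine Nat.card_eq_one_iff_unique.2 ⟨⟨fun a b => ?_⟩, ⟨Quot.mk _ v⟩⟩
  induction a using Quot.ind
  induction b using Quot.ind
  exact congrArg _ (hs.elim _ _)

section Bouquet

variable [Fintype E] {G : RibbonGraph V E}

/-- The ends of `e` cut the circle into two arcs, and the positions below `d` form the first.
Alternation means that exactly one end of `e'` lies there. -/
theorem IsBouquet.interlaced_iff_xor (hG : G.IsBouquet) {e e' : E} (hne : e ≠ e') {d : ℕ}
    (hd : d < Fintype.card (E × Bool)) (hde : G.rot^[d] (e, false) = (e, true)) :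
    G.Interlaced e e' ↔ Xor (∃ j < d, G.rot^[j] (e, false) = (e', true))
      (∃ j < d, G.rot^[j] (e, false) = (e', false)) := by
  have hσ := hG.sameCycle
  have key (t : Bool) : CyclicallyOrdered G.rot (e, false) (e', t) (e, true) (e', !t) ↔
      (∃ j < d, G.rot^[j] (e, false) = (e', t)) ∧
        ¬ ∃ j < d, G.rot^[j] (e, false) = (e', !t) := by
    constructor
    · rintro ⟨i, j, k, hi, hij, hjk, hk, h1, h2, h3⟩
      rw [Equiv.Perm.minimalPeriod_eq_card_of_sameCycle hσ] at hk
      obtain rfl : j = d :=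
        Equiv.Perm.iterate_inj_of_sameCycle hσ (by omega) hd (h2.trans hde.symm)
      refine ⟨⟨i, hij, h1⟩, ?_⟩
      rintro ⟨l, hl, h4⟩
      have := Equiv.Perm.iterate_inj_of_sameCycle hσ (by omega) hk (h4.trans h3.symm)
      omega
    · rintro ⟨⟨i, hi, h1⟩, hn⟩
      obtain ⟨k, hk, h3⟩ := Equiv.Perm.exists_iterate_eq_of_sameCycle hσ (e, false) (e', !t)
      have hi0 : i ≠ 0 := by
        rintro rfl
        exact hne (congrArg Prod.fst h1)
      have hkd : k ≠ d := by
        rintro rfl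
        exact hne (congrArg Prod.fst (hde.symm.trans h3))
      have hdk : ¬ k < d := fun h => hn ⟨k, h, h3⟩
      refine ⟨i, d, k, by omega, hi, by omega, ?_, h1, hde, h3⟩
      rwa [Equiv.Perm.minimalPeriod_eq_card_of_sameCycle hσ]
  rw [interlaced_iff]
  simp only [Bool.exists_bool, key, Bool.not_false, Bool.not_true, Xor, ne_eq, hne,
    not_false_eq_true, true_and]
  exact or_comm

open Classical in
-- The range includes the starting end of `e` but not its other end, hence the single `x e`. An edge
-- that is not interlaced with `e` contributes zero or `2 * x e'`, which is zero.
theorem IsBouquet.sum_between (hG : G.IsBouquet) (x : E → ZMod 2) (e : E) {d : ℕ}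
    (hd : d < Fintype.card (E × Bool)) (hde : G.rot^[d] (e, false) = (e, true)) :
    ∑ j ∈ Finset.range d, x (G.rot^[j] (e, false)).1 =
      x e + ∑ e', if G.Interlaced e e' then x e' else 0 := by
  rw [Equiv.Perm.sum_range_iterate_of_sameCycle hG.sameCycle (e, false) (fun h => x h.1) hd.le,
    Fintype.sum_prod_type]
  have hx : x e = ∑ e', if e' = e then x e' else 0 := by simp
  rw [hx, ← Finset.sum_add_distrib]
  refine Finset.sum_congr rfl fun e' _ => ?_
  rw [Fintype.sum_bool]
  by_cases h : e' = e
  · subst h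
    have h0 : ∃ j < d, G.rot^[j] (e', false) = (e', false) := by
      refine ⟨0, Nat.pos_of_ne_zero ?_, rfl⟩
      rintro rfl
      simp at hde
    have h1 : ¬ ∃ j < d, G.rot^[j] (e', false) = (e', true) := by
      rintro ⟨j, hj, hje⟩
      have := Equiv.Perm.iterate_inj_of_sameCycle hG.sameCycle (by omega) hd (hje.trans hde.symm)
      omega
    have h2 : ¬ G.Interlaced e' e' := fun h => h.1 rfl
    rw [if_pos h0, if_neg h1, if_neg h2, if_pos rfl, add_comm]
  · rw [if_neg h, zero_add]
    have hI := hG.interlaced_iff_xor (Ne.symm h) hd hde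
    have h2 : x e' + x e' = 0 := CharTwo.add_self_eq_zero _
    by_cases h0 : ∃ j < d, G.rot^[j] (e, false) = (e', false) <;>
      by_cases h1 : ∃ j < d, G.rot^[j] (e, false) = (e', true) <;>
      simp [h0, h1, hI, h2]

open Classical in
/-- The kernel modulo two of the adjacency matrix of the intersection graph, with the indicator of
the twisted edges on its diagonal. -/
def IntersectionKernel (G : RibbonGraph V E) : Type _ :=
  {x : E → ZMod 2 // ∀ e, (if e ∈ G.twisted then x e else 0) +
    ∑ e', (if G.Interlaced e e' then x e' else 0) = 0}

open Classical in
theorem IsBouquet.apply_true_eq (hG : G.IsBouquet) {x : E → ZMod 2} {u : E × Bool → ZMod 2}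
    (hu : ∀ h, u (G.rot h) = u h + x h.1) (e : E) :
    u (e, true) = u (e, false) + (x e + ∑ e', if G.Interlaced e e' then x e' else 0) := by
  obtain ⟨d, hd, hde⟩ :=
    Equiv.Perm.exists_iterate_eq_of_sameCycle hG.sameCycle (e, false) (e, true)
  rw [← hG.sum_between x e hd hde, ← hde]
  exact Equiv.Perm.apply_iterate_eq_add_sum (y := fun h => x h.1) hu (e, false) d

/-- The factor 2 counts the value at a base point, which exists because `E` is nonempty; the jumps
form the kernel vector. -/
theorem IsBouquet.card_quot_boundaryArc_fun (hG : G.IsBouquet) [Nonempty E] :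
    Nat.card (Quot G.BoundaryArc → ZMod 2) = 2 * Nat.card G.IntersectionKernel := by
  classical
  obtain ⟨e₀⟩ := ‹Nonempty E›
  have h2 : (2 : ZMod 2) = 0 := rfl
  have hker (q : Quot G.BoundaryArc → ZMod 2) (e : E) := hG.apply_true_eq
    (x := fun e => q (Quot.mk _ ((e, false), true)) - q (Quot.mk _ ((e, false), false)))
    (u := fun h => q (Quot.mk _ (h, false))) (apply_rot_eq q) e
  let Φ (q : Quot G.BoundaryArc → ZMod 2) : ZMod 2 × G.IntersectionKernel :=
    (q (Quot.mk _ ((e₀, false), false)),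
      ⟨fun e => q (Quot.mk _ ((e, false), true)) - q (Quot.mk _ ((e, false), false)), fun e => by
        have h := hker q e
        split_ifs with he
        · rw [← Quot.sound (BoundaryArc.twistedSide e false he)] at h
          linear_combination -h
        · rw [← Bool.not_true, ← Quot.sound (BoundaryArc.untwistedSide e true he)] at h
          simp only [Bool.not_true] at h
          linear_combination -h⟩)
  have hΦ : Function.Bijective Φ := by
    constructor
    · intro q r hqr
      have hx : ∀ e, q (Quot.mk _ ((e, false), true)) - q (Quot.mk _ ((e, false), false)) =
          r (Quot.mk _ ((e, false), true)) - r (Quot.mk _ ((e, false), false)) :=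
        fun e => congrFun (congrArg Subtype.val (congrArg Prod.snd hqr)) e
      have hqr' : (fun h => q (Quot.mk _ (h, false))) = fun h => r (Quot.mk _ (h, false)) := by
        refine Equiv.Perm.eq_of_increments_eq hG.sameCycle (apply_rot_eq q) (fun h => ?_)
          (congrArg Prod.fst hqr)
        rw [hx]
        exact apply_rot_eq r h
      funext a
      induction a using Quot.ind with
      | mk p =>
        obtain ⟨h, _ | _⟩ := p
        · exact congrFun hqr' h
        · rw [Quot.sound (BoundaryArc.vertexArc h)]
          exact congrFun hqr' (G.rot h)
    · rintro ⟨c, x, hx⟩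
      -- Each edge is met twice in a full turn, so the increments can be integrated around the
      -- cycle.
      have hsum : ∑ h : E × Bool, x h.1 = 0 := by
        rw [Fintype.sum_prod_type]
        exact Finset.sum_eq_zero fun e _ =>
          (Fintype.sum_bool _).trans (CharTwo.add_self_eq_zero (x e))
      obtain ⟨u, hu0, hu⟩ :=
        Equiv.Perm.exists_increments_eq hG.sameCycle (e₀, false) c hsum
      -- Vertex arcs force the value at `(h, true)` to be `u (G.rot h)`; compatibility with the
      -- sides of the ribbons is the kernel equation.
      have hresp : ∀ p p', G.BoundaryArc p p' →
          (if p.2 then u (G.rot p.1) else u p.1) = if p'.2 then u (G.rot p'.1) else u p'.1 := by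
        intro p p' hp
        cases hp with
        | vertexArc h => simp
        | untwistedSide e b he =>
          have h1 := hG.apply_true_eq hu e
          have h3 := hx e
          rw [if_neg he] at h3
          cases b
          · simp [hu]
            linear_combination -h1 - h3 - x e * h2
          · simp [hu]
            linear_combination -h1 - h3
        | twistedSide e b he =>
          have h1 := hG.apply_true_eq hu e
          have h3 := hx e
          rw [if_pos he] at h3
          cases b <;> simp [hu] <;> linear_combination -h1 - h3
      refine ⟨Quot.lift _ hresp, Prod.ext (by simpa [Φ] using hu0) (Subtype.ext ?_)⟩
      funext e
      simp [Φ, hu]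
  rw [Nat.card_congr (Equiv.ofBijective Φ hΦ), Nat.card_prod, Nat.card_zmod]

theorem IsBouquet.two_pow_card_face (hG : G.IsBouquet) :
    2 ^ Nat.card G.Face = 2 * Nat.card G.IntersectionKernel := by
  have := hG.subsingleton
  have : Finite (Quot G.BoundaryArc) := Finite.of_surjective _ Quot.mk_surjective
  rw [Face, Nat.card_sum, pow_add]
  -- Without edges, the only face is the circle of the isolated disc, and the kernel is trivial.
  rcases isEmpty_or_nonempty E with hE | hE
  · have : Unique G.IntersectionKernel :=
      ⟨⟨⟨isEmptyElim, isEmptyElim⟩⟩, fun x => Subtype.ext (funext isEmptyElim)⟩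
    have hV : Nat.card {v // ∀ h : E × Bool, G.vert h ≠ v} = 1 :=
      (Nat.card_congr (Equiv.subtypeUnivEquiv fun v h => isEmptyElim h)).trans hG
    have : IsEmpty (Quot G.BoundaryArc) := Function.isEmpty Quot.out
    rw [hV, Nat.card_unique (α := G.IntersectionKernel), Nat.card_of_isEmpty (α := Quot G.BoundaryArc)]
    norm_num
  · have hV : IsEmpty {v // ∀ h : E × Bool, G.vert h ≠ v} :=
      ⟨fun v => v.2 (hE.some, false) (Subsingleton.elim _ _)⟩
    rw [Nat.card_of_isEmpty (α := {v // ∀ h : E × Bool, G.vert h ≠ v}), pow_zero, mul_one,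
      ← hG.card_quot_boundaryArc_fun, Nat.card_fun, Nat.card_zmod]

end Bouquet

/-! ### Invariance of the Euler genus -/

variable {V₁ E₁ V₂ E₂ : Type*} [Fintype E₁] [Fintype E₂]

theorem card_intersectionKernel_congr {G₁ : RibbonGraph V₁ E₁} {G₂ : RibbonGraph V₂ E₂}
    (φ : G₁.intersectionGraph ≃g G₂.intersectionGraph)
    (hφ : ∀ e, φ e ∈ G₂.twisted ↔ e ∈ G₁.twisted) :
    Nat.card G₁.IntersectionKernel = Nat.card G₂.IntersectionKernel := by
  classical
  refine Nat.card_congr (Equiv.subtypeEquiv (Equiv.arrowCongr φ.toEquiv (Equiv.refl _)) fun x => ?_)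
  have hI (a b : E₁) : G₂.Interlaced (φ a) (φ b) ↔ G₁.Interlaced a b := φ.map_rel_iff
  refine φ.toEquiv.forall_congr fun {e} => ?_
  rw [← φ.toEquiv.sum_comp]
  have hx (a : E₁) : Equiv.arrowCongr φ.toEquiv (Equiv.refl (ZMod 2)) x (φ a) = x a :=
    congrArg x (φ.symm_apply_apply a)
  change _ ↔ (if φ e ∈ G₂.twisted then Equiv.arrowCongr φ.toEquiv (Equiv.refl _) x (φ e) else 0) +
    ∑ a, (if G₂.Interlaced (φ e) (φ a) then
      Equiv.arrowCongr φ.toEquiv (Equiv.refl _) x (φ a) else 0) = 0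
  simp only [hφ, hI, hx]

theorem IsBouquet.eulerGenus_congr {G₁ : RibbonGraph V₁ E₁} {G₂ : RibbonGraph V₂ E₂}
    (h₁ : G₁.IsBouquet) (h₂ : G₂.IsBouquet)
    (φ : G₁.intersectionGraph ≃g G₂.intersectionGraph)
    (hφ : ∀ e, φ e ∈ G₂.twisted ↔ e ∈ G₁.twisted) : G₁.eulerGenus = G₂.eulerGenus := by
  have hF : Nat.card G₁.Face = Nat.card G₂.Face := by
    refine Nat.pow_right_injective le_rfl ?_
    simp only [h₁.two_pow_card_face, h₂.two_pow_card_face, card_intersectionKernel_congr φ hφ]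
  rw [eulerGenus, eulerGenus, eulerChar, eulerChar, hF, h₁.card_component, h₂.card_component,
    h₁, h₂, Nat.card_congr φ.toEquiv]

theorem mem_twisted_partialPetrial (G : RibbonGraph V E) (A : Finset E) (e : E) :
    e ∈ (G.partialPetrial A).twisted ↔ Xor (e ∈ A) (e ∈ G.twisted) := by
  by_cases he : e ∈ A
  · rcases Int.units_eq_one_or (G.sign (e, false)) with h | h <;>
      rcases Int.units_eq_one_or (G.sign (e, true)) with h' | h' <;>
      simp [twisted, partialPetrial, he, h, h']
  · simp [twisted, partialPetrial, he]

end RibbonGraph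

/-! ### Comparing the polynomials -/

theorem Finset.neg_one_pow_card_symmDiff {α R : Type*} [DecidableEq α] [CommRing R]
    (A S : Finset α) : (-1 : R) ^ (A ∆ S).card = (-1) ^ A.card * (-1) ^ S.card := by
  have h1 := Finset.card_sdiff_add_card_inter A S
  have h2 := Finset.card_sdiff_add_card_inter S A
  have h3 : (A ∆ S).card = (A \ S).card + (S \ A).card :=
    Finset.card_union_of_disjoint disjoint_sdiff_sdiff
  rw [Finset.inter_comm] at h2
  have h4 : (-1 : R) ^ (A ∩ S).card * (-1) ^ (A ∩ S).card = 1 := by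
    rw [← pow_add, Even.neg_one_pow ⟨_, rfl⟩]
  rw [h3, ← h1, ← h2]
  simp only [pow_add]
  linear_combination (-(-1 : R) ^ (A \ S).card * (-1) ^ (S \ A).card) * h4

theorem RibbonGraph.IsBouquet.modifiedPartialPetrialPolynomial_congr
    {V₁ E₁ V₂ E₂ : Type*} [Fintype E₁] [Fintype E₂]
    {B₁ : RibbonGraph V₁ E₁} {B₂ : RibbonGraph V₂ E₂}
    (hB₁ : B₁.IsBouquet) (hB₂ : B₂.IsBouquet)
    (φ : B₁.intersectionGraph ≃g B₂.intersectionGraph) :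
    B₁.modifiedPartialPetrialPolynomial =
      (-1) ^ ((φ '' B₁.twisted) ∆ B₂.twisted).ncard * B₂.modifiedPartialPetrialPolynomial := by
  classical
  obtain ⟨S, hS⟩ := (Set.toFinite ((φ '' B₁.twisted) ∆ B₂.twisted)).exists_finset_coe
  have hmem (e : E₁) : φ e ∈ S ↔ Xor (e ∈ B₁.twisted) (φ e ∈ B₂.twisted) := by
    rw [← Finset.mem_coe, hS, Set.mem_symmDiff, φ.injective.mem_set_image, Xor]
  rw [← hS, Set.ncard_coe_finset, modifiedPartialPetrialPolynomial,
    modifiedPartialPetrialPolynomial, Finset.mul_sum]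
  refine Fintype.sum_equiv (φ.toEquiv.finsetCongr.trans (symmDiff_right_involutive S).toPerm)
    _ _ fun A => ?_
  -- `A'` is chosen so that `A' ∆ T₂ = φ(A ∆ T₁)`.
  set A' : Finset E₂ := S ∆ A.map φ.toEquiv.toEmbedding
  have hA' : A'.card = (S ∆ A.map φ.toEquiv.toEmbedding).card := rfl
  have hφ (e : E₁) :
      φ e ∈ (B₂.partialPetrial A').twisted ↔ e ∈ (B₁.partialPetrial A).twisted := by
    have he : φ e ∈ A.map φ.toEquiv.toEmbedding ↔ e ∈ A :=
      Finset.mem_map' φ.toEquiv.toEmbedding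
    rw [mem_twisted_partialPetrial, mem_twisted_partialPetrial, Finset.mem_symmDiff, he, hmem]
    simp only [Xor]
    tauto
  -- Half-twists change neither the disc nor the rotation, so `hB₁`, `hB₂` and `φ` serve for the
  -- partial Petrials as they stand.
  have hgenus : (B₁.partialPetrial A).eulerGenus = (B₂.partialPetrial A').eulerGenus :=
    IsBouquet.eulerGenus_congr (G₁ := B₁.partialPetrial A) (G₂ := B₂.partialPetrial A')
      hB₁ hB₂ φ hφ
  have hsign : (-1 : ℤ[X]) ^ S.card * (-1) ^ S.card = 1 := by
    rw [← pow_add, Even.neg_one_pow ⟨_, rfl⟩]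
  change _ = (-1) ^ S.card * ((-1) ^ A'.card * X ^ (B₂.partialPetrial A').eulerGenus.toNat)
  rw [hA', Finset.neg_one_pow_card_symmDiff, Finset.card_map, hgenus]
  linear_combination
    (-(-1) ^ A.card * X ^ (B₂.partialPetrial A').eulerGenus.toNat) * hsign

theorem mainTheorem6 {V₁ E₁ V₂ E₂ : Type*} [Fintype E₁] [Fintype E₂]
    (B₁ : RibbonGraph V₁ E₁) (B₂ : RibbonGraph V₂ E₂)
    (hB₁ : B₁.IsBouquet) (hB₂ : B₂.IsBouquet) :
    (Nonempty (SignedGraph.Iso B₁.signedIntersectionGraph B₂.signedIntersectionGraph) →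
      B₁.modifiedPartialPetrialPolynomial = B₂.modifiedPartialPetrialPolynomial) ∧
    ∀ φ : B₁.intersectionGraph ≃g B₂.intersectionGraph,
      B₁.modifiedPartialPetrialPolynomial =
        (-1) ^ ((φ '' B₁.twisted) ∆ B₂.twisted).ncard * B₂.modifiedPartialPetrialPolynomial := by
  classical
  refine ⟨fun ⟨ψ⟩ => ?_, hB₁.modifiedPartialPetrialPolynomial_congr hB₂⟩
  let φ : B₁.intersectionGraph ≃g B₂.intersectionGraph := ψ.toRelIso
  have hφ (e : E₁) : φ e ∈ B₂.twisted ↔ e ∈ B₁.twisted := by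
    have h : (if φ e ∈ B₂.twisted then (-1 : ℤˣ) else 1) = if e ∈ B₁.twisted then -1 else 1 :=
      ψ.sign_eq e
    by_cases h₁ : e ∈ B₁.twisted <;> by_cases h₂ : φ e ∈ B₂.twisted <;> simp_all
  have himage : φ '' B₁.twisted = B₂.twisted := by
    ext e
    obtain ⟨e, rfl⟩ := φ.surjective e
    rw [φ.injective.mem_set_image, hφ]
  simpa [himage] using hB₁.modifiedPartialPetrialPolynomial_congr hB₂ φ
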